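/- Let $\mathcal G$ be the group of finite sets of nonnegative integers under symmetric difference (neutral element $\emptyset$), let $\mathbf C[\mathcal G]$ be its (commutative) complex group algebra, and let $\psi:\mathbf C[\mathcal G]\to\mathbf C$, $\psi\big(\sum_A x_A A\big)=x_\emptyset$, be its canonical trace. Fix $p\ge 1$, integers $r_1,\dots,r_p\ge 0$ and real numbers $t_0<t_1<\dots<t_p$. For $i=1,\dots,p$ and $n\ge 1$ define $$L_i(n)=n^{-r_i/2}\sum_{(a_1,\dots,a_{r_i})}\{a_1,\dots,a_{r_i}\}\in\mathbf C[\mathcal G],$$ where the sum runs over all $r_i$-tuples of pairwise distinct nonnegative integers of $(nt_{i-1},nt_i]$ (for $r_i=0$, $L_i(n)=\emptyset$ is the unit of the algebra). Then $L_1(n),\dots,L_p(n)$ are asymptotically independent as $n\to\infty$, that is: there exist independent real random variables $X_1,\dots,X_p$ on some probability space, with moments of all orders, such that for every polynomial $P$ in $p$ noncommuting variables with complex coefficients, $$\lim_{n\to\infty}\psi\big(P(L_1(n),\dots,L_p(n))\big)=\mathbf E\big[P(X_1,\dots,X_p)\big].$$ -/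

import Mathlib

open Filter Topology MeasureTheory ProbabilityTheory

/-- The group of finite sets of nonnegative integers under symmetric difference.
The group law is written additively: `A + B` is the symmetric difference of `A` and `B`,
and `0` is the empty set. -/
abbrev FinSetGroup : Type := AsBoolRing (Finset ℕ)

/-- The complex group algebra of the group of finite sets of nonnegative integers. -/
abbrev SetAlgebra : Type := AddMonoidAlgebra ℂ FinSetGroup

/-- The canonical trace: the coefficient of the neutral element (the empty set). -/
noncomputable def canonicalTrace : SetAlgebra →ₗ[ℂ] ℂ where
  toFun x := x.coeff 0
  map_add' _ _ := rfl
  map_smul' _ _ := rfl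

/-- The nonnegative integers of the half-open real interval `(s, t]`. -/
noncomputable def integersIoc (s t : ℝ) : Finset ℕ :=
  (Finset.range (⌊t⌋₊ + 1)).filter (fun a => s < (a : ℝ) ∧ (a : ℝ) ≤ t)

theorem mem_integersIoc (s t : ℝ) (a : ℕ) :
    a ∈ integersIoc s t ↔ s < (a : ℝ) ∧ (a : ℝ) ≤ t := by
  unfold integersIoc
  rw [Finset.mem_filter, Finset.mem_range, and_iff_right_iff_imp]
  intro h
  exact Nat.lt_succ_of_le (Nat.le_floor h.2)

open Classical in
/-- `n ^ (-r/2) ∑ {a₁, …, a_r}`, over all `r`-tuples of pairwise distinct nonnegative integers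
of `(n s, n t]`. -/
noncomputable def normalizedSum (r : ℕ) (s t : ℝ) (n : ℕ) : SetAlgebra :=
  (((n : ℝ) ^ (-(r : ℝ) / 2) : ℝ) : ℂ) •
    ∑ a ∈ (Fintype.piFinset (fun _ : Fin r => integersIoc (n * s) (n * t))).filter
        (fun a => Function.Injective a),
      (AddMonoidAlgebra.single (toBoolRing (Finset.univ.image a)) 1 : SetAlgebra)

/-- The noncommutative distribution of a family `x` of elements of a complex algebra endowed with
a linear form `φ`: it maps a polynomial `P` in noncommuting variables to `φ (P (x))`. -/
noncomputable def ncDistribution {A ι : Type*} [Ring A] [Algebra ℂ A] (φ : A →ₗ[ℂ] ℂ)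
    (x : ι → A) : FreeAlgebra ℂ ι →ₗ[ℂ] ℂ :=
  φ ∘ₗ (FreeAlgebra.lift ℂ x).toLinearMap

/-- Asymptotic independence of the families `x n = (x n i)_i` as `n → ∞`: their distribution
converges, on every polynomial, to the joint distribution of a family of independent real random
variables having moments of all orders. -/
def AsymptoticallyIndependent {A ι : Type*} [Ring A] [Algebra ℂ A] (φ : A →ₗ[ℂ] ℂ)
    (x : ℕ → ι → A) : Prop :=
  ∃ (Ω : Type) (_ : MeasurableSpace Ω) (μ : Measure Ω) (X : ι → Ω → ℝ),
    IsProbabilityMeasure μ ∧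
    (∀ i, Measurable (X i)) ∧
    (∀ i, ∀ q : ℕ, MemLp (X i) q μ) ∧
    iIndepFun X μ ∧
    ∀ P : FreeAlgebra ℂ ι,
      Tendsto (fun n => ncDistribution φ (x n) P) atTop
        (𝓝 (∫ ω, FreeAlgebra.lift ℂ (fun i => ((X i ω : ℝ) : ℂ)) P ∂μ))

/-!
Put `L r = n ^ (-r/2) ∑ {a₁, …, a_r}` over the `r`-tuples of pairwise distinct elements of a set `I`
of `N` integers, so that `L r` is `r!` times an elementary symmetric function of the generators.
Since every generator squares to the unit, multiplying `L 1` by `L (r + 1)` gives `L (r + 2)` plus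
`(r + 1) (N - r) / n` times `L r`. If `N / n → σ²`, this becomes in the limit the three-term
recurrence of the Hermite polynomials of variance `σ²`. The trace of `L r` and the Gaussian
expectation of the `r`-th Hermite polynomial are both `1` for `r = 0` and `0` otherwise, and
together with the recurrence these values determine all moments. Hence `L r` converges in moments
to a Hermite polynomial of a Gaussian variable. Finally, sums over disjoint sets of integers live
on independent subgroups, over which the trace is multiplicative.
-/

/-- Three-term recurrence `p (r + 2) = p 1 * p (r + 1) - c r • p r`, starting from `p 0 = 1`, as
satisfied by a sequence of monic orthogonal polynomials with symmetric weight; here `p` takes its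
values in an arbitrary algebra. -/
structure IsThreeTermRecurrence {𝕜 A : Type*} [CommRing 𝕜] [Ring A] [Algebra 𝕜 A]
    (c : ℕ → 𝕜) (p : ℕ → A) : Prop where
  zero : p 0 = 1
  add_two : ∀ r, p (r + 2) = p 1 * p (r + 1) - c r • p r

namespace IsThreeTermRecurrence

theorem one_pow_succ_mul {𝕜 A : Type*} [CommRing 𝕜] [Ring A] [Algebra 𝕜 A] {c : ℕ → 𝕜}
    {p : ℕ → A} (hp : IsThreeTermRecurrence c p) (j r : ℕ) :
    p 1 ^ (j + 1) * p (r + 1) = p 1 ^ j * p (r + 2) + c r • (p 1 ^ j * p r) := by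
  rw [hp.add_two, mul_sub, mul_smul_comm, sub_add_cancel, pow_succ, mul_assoc]

variable {𝕜 A B E α : Type*} [CommRing 𝕜] [TopologicalSpace 𝕜]
  [Ring A] [Algebra 𝕜 A] [Ring B] [Algebra 𝕜 B]
  [AddCommGroup E] [Module 𝕜 E] [TopologicalSpace E] [IsTopologicalAddGroup E]
  [ContinuousSMul 𝕜 E] {l : Filter α} {φ : A →ₗ[𝕜] E} {Φ : B →ₗ[𝕜] E}
  {c : α → ℕ → 𝕜} {b : ℕ → 𝕜} {p : α → ℕ → A} {q : ℕ → B}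

theorem tendsto_one_pow_mul (hp : ∀ n, IsThreeTermRecurrence (c n) (p n))
    (hq : IsThreeTermRecurrence b q) (hc : ∀ r, Tendsto (fun n => c n r) l (𝓝 (b r)))
    (h : ∀ r, Tendsto (fun n => φ (p n r)) l (𝓝 (Φ (q r)))) (j r : ℕ) :
    Tendsto (fun n => φ (p n 1 ^ j * p n r)) l (𝓝 (Φ (q 1 ^ j * q r))) := by
  induction j generalizing r with
  | zero => simpa using h r
  | succ j ih =>
    cases r with
    | zero => simpa [(hp _).zero, hq.zero, pow_succ] using ih 1
    | succ r =>
      simp only [(hp _).one_pow_succ_mul, hq.one_pow_succ_mul, map_add, map_smul]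
      exact (ih (r + 2)).add ((hc r).smul (ih r))

theorem tendsto_one_pow_mul_mul (hp : ∀ n, IsThreeTermRecurrence (c n) (p n))
    (hq : IsThreeTermRecurrence b q) (hc : ∀ r, Tendsto (fun n => c n r) l (𝓝 (b r)))
    {w : α → A} {u : B}
    (h : ∀ j, Tendsto (fun n => φ (p n 1 ^ j * w n)) l (𝓝 (Φ (q 1 ^ j * u)))) (r j : ℕ) :
    Tendsto (fun n => φ (p n 1 ^ j * (p n r * w n))) l (𝓝 (Φ (q 1 ^ j * (q r * u)))) := by
  induction r using Nat.twoStepInduction generalizing j with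
  | zero => simpa [(hp _).zero, hq.zero] using h j
  | one => simpa [pow_succ, mul_assoc] using h (j + 1)
  | more r ih₀ ih₁ =>
    simp only [(hp _).add_two, hq.add_two, sub_mul, mul_sub, smul_mul_assoc, mul_smul_comm,
      map_sub, map_smul]
    refine Tendsto.sub ?_ ((hc r).smul (ih₀ j))
    simpa only [pow_succ, mul_assoc] using ih₁ (j + 1)

theorem tendsto_pow (hp : ∀ n, IsThreeTermRecurrence (c n) (p n))
    (hq : IsThreeTermRecurrence b q) (hc : ∀ r, Tendsto (fun n => c n r) l (𝓝 (b r)))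
    (h : ∀ r, Tendsto (fun n => φ (p n r)) l (𝓝 (Φ (q r)))) (r k : ℕ) :
    Tendsto (fun n => φ (p n r ^ k)) l (𝓝 (Φ (q r ^ k))) := by
  suffices ∀ j, Tendsto (fun n => φ (p n 1 ^ j * p n r ^ k)) l (𝓝 (Φ (q 1 ^ j * q r ^ k))) by
    simpa using this 0
  induction k with
  | zero =>
    intro j
    simpa [(hp _).zero, hq.zero] using tendsto_one_pow_mul hp hq hc h j 0
  | succ k ih =>
    simp only [pow_succ' _ k]
    exact tendsto_one_pow_mul_mul hp hq hc ih r

end IsThreeTermRecurrence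

/-! ### Elementary symmetric functions -/

theorem esymm_cons {R : Type*} [CommSemiring R] (a : R) (s : Multiset R) (n : ℕ) :
    (a ::ₘ s).esymm (n + 1) = s.esymm (n + 1) + a * s.esymm n := by
  simp [Multiset.esymm, Multiset.powersetCard_cons, Multiset.sum_map_mul_left]

theorem esymm_add_two_of_mul_self_eq {R : Type*} [CommRing R] {c : R} {s : Multiset R}
    (hs : ∀ a ∈ s, a * a = c) (r : ℕ) :
    (r + 2) * s.esymm (r + 2) =
      s.esymm 1 * s.esymm (r + 1) - (s.card - r) * c * s.esymm r := by
  have esymm_zero (s : Multiset R) : s.esymm 0 = 1 := by simp [Multiset.esymm]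
  induction s using Multiset.induction_on generalizing r with
  | empty => cases r <;> simp [Multiset.esymm, Multiset.powersetCard_zero_right]
  | cons a s ih =>
    have ha : a * a = c := hs a (Multiset.mem_cons_self a s)
    replace ih := ih fun x hx => hs x (Multiset.mem_cons_of_mem hx)
    cases r with
    | zero =>
      have ih₀ := ih 0
      simp only [esymm_cons, esymm_zero, Multiset.card_cons, Nat.cast_add, Nat.cast_one,
        Nat.cast_zero, zero_add] at ih₀ ⊢
      linear_combination ih₀ - ha
    | succ r =>
      have ih₀ := ih r
      have ih₁ := ih (r + 1)
      simp only [esymm_cons, esymm_zero, Multiset.card_cons, Nat.cast_add, Nat.cast_one,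
        zero_add] at ih₀ ih₁ ⊢
      linear_combination ih₁ + a * ih₀ - s.esymm (r + 1) * ha

theorem isThreeTermRecurrence_factorial_smul_esymm {𝕜 A : Type*} [CommRing 𝕜] [CommRing A]
    [Algebra 𝕜 A] {c : 𝕜} {s : Multiset A} (hs : ∀ a ∈ s, a * a = algebraMap 𝕜 A c) :
    IsThreeTermRecurrence (fun r => (r + 1) * (s.card - r) * c)
      (fun r => r.factorial • s.esymm r) where
  zero := by simp [Multiset.esymm]
  add_two r := by
    have h := esymm_add_two_of_mul_self_eq hs r
    simp only [Algebra.smul_def, Nat.factorial_succ, Nat.factorial_zero, map_mul,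
      map_add, map_sub, map_natCast, map_one]
    push_cast
    linear_combination (r + 1) * (r.factorial : A) * h

theorem card_filter_injective_piFinset (κ : Type*) {ι : Type*} [Fintype κ] [DecidableEq κ]
    [DecidableEq ι] (s : Finset ι) :
    ((Fintype.piFinset fun _ : κ => s).filter Function.Injective).card =
      s.card.descFactorial (Fintype.card κ) := by
  rw [← Fintype.card_coe s, ← Fintype.card_embedding_eq, ← Finset.card_univ]
  symm
  refine Finset.card_bij (fun e _ i => (e i : ι)) (fun e _ => ?_) (fun e _ f _ h => ?_)
    fun a ha => ?_
  · exact Finset.mem_filter.2 ⟨Fintype.mem_piFinset.2 fun i => (e i).2,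
      Subtype.val_injective.comp e.injective⟩
  · ext i
    exact congrFun h i
  · simp only [Finset.mem_filter, Fintype.mem_piFinset] at ha
    exact ⟨⟨fun i => ⟨a i, ha.1 i⟩, fun i j h => ha.2 (congrArg Subtype.val h)⟩,
      Finset.mem_univ _, rfl⟩

theorem sum_injective_prod_eq_factorial_smul_esymm {ι R : Type*} [DecidableEq ι] [CommSemiring R]
    (f : ι → R) (I : Finset ι) (r : ℕ) :
    ∑ a ∈ (Fintype.piFinset fun _ : Fin r => I).filter Function.Injective, ∏ i, f (a i) =
      r.factorial • (I.val.map f).esymm r := by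
  have image_mem : ∀ a ∈ (Fintype.piFinset fun _ : Fin r => I).filter Function.Injective,
      Finset.univ.image a ∈ I.powersetCard r := by
    intro a ha
    rw [Finset.mem_filter, Fintype.mem_piFinset] at ha
    rw [Finset.mem_powersetCard, Finset.card_image_of_injective _ ha.2, Finset.image_subset_iff]
    exact ⟨fun i _ => ha.1 i, Finset.card_fin r⟩
  rw [← Finset.sum_fiberwise_of_maps_to image_mem, Finset.esymm_map_val, Finset.smul_sum]
  refine Finset.sum_congr rfl fun s hs => ?_
  obtain ⟨hsI, hsr⟩ := Finset.mem_powersetCard.1 hs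
  have fiber : (((Fintype.piFinset fun _ : Fin r => I).filter Function.Injective).filter
      fun a => Finset.univ.image a = s) =
        (Fintype.piFinset fun _ : Fin r => s).filter Function.Injective := by
    ext a
    simp only [Finset.mem_filter, Fintype.mem_piFinset]
    constructor
    · rintro ⟨⟨-, ha⟩, rfl⟩
      exact ⟨fun i => Finset.mem_image_of_mem a (Finset.mem_univ i), ha⟩
    · rintro ⟨has, ha⟩
      refine ⟨⟨fun i => hsI (has i), ha⟩, Finset.eq_of_subset_of_card_le ?_ ?_⟩
      · exact Finset.image_subset_iff.2 fun i _ => has i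
      · rw [Finset.card_image_of_injective _ ha, hsr, Finset.card_fin]
  have prod_eq : ∀ a ∈ (Fintype.piFinset fun _ : Fin r => s).filter Function.Injective,
      ∏ i, f (a i) = ∏ x ∈ s, f x := by
    intro a ha
    rw [← fiber, Finset.mem_filter, Finset.mem_filter] at ha
    rw [← ha.2, Finset.prod_image ha.1.2.injOn]
  rw [fiber, Finset.sum_congr rfl prod_eq, Finset.sum_const, card_filter_injective_piFinset,
    Fintype.card_fin, hsr, Nat.descFactorial_self]

/-! ### Hermite polynomials of a Gaussian variable -/

theorem memLp_polynomial_eval {Ω : Type*} [MeasurableSpace Ω] {μ : Measure Ω} [IsFiniteMeasure μ]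
    {X : Ω → ℝ} (hX : ∀ q : ℕ, MemLp X q μ) (P : Polynomial ℝ) (q : ℕ) :
    MemLp (fun ω => P.eval (X ω)) q μ := by
  induction P using Polynomial.induction_on generalizing q with
  | C a => simpa using memLp_const a
  | add P Q hP hQ =>
    simp only [Polynomial.eval_add]
    exact (hP q).add (hQ q)
  | monomial k a ih =>
    have : ENNReal.HolderTriple (2 * q : ℕ) (2 * q : ℕ) q := ⟨by
      rw [Nat.cast_mul, ENNReal.mul_inv (by simp) (by simp), ← add_mul, Nat.cast_two,
        ENNReal.inv_two_add_inv_two, one_mul]⟩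
    simpa [pow_succ, mul_assoc] using MemLp.mul' (hX (2 * q)) (ih (2 * q))

theorem integrable_polynomial_eval {Ω : Type*} [MeasurableSpace Ω] {μ : Measure Ω}
    [IsFiniteMeasure μ] {X : Ω → ℝ} (hX : ∀ q : ℕ, MemLp X q μ) (P : Polynomial ℝ) :
    Integrable (fun ω => P.eval (X ω)) μ :=
  memLp_one_iff_integrable.1 (by simpa using memLp_polynomial_eval hX P 1)

theorem hasDerivAt_gaussianPDFReal (μ : ℝ) (v : NNReal) (x : ℝ) :
    HasDerivAt (gaussianPDFReal μ v) (-((x - μ) / v) * gaussianPDFReal μ v x) x := by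
  have h := ((((hasDerivAt_id x).sub_const μ).pow 2).neg.div_const (2 * (v : ℝ))).exp.const_mul
    (√(2 * Real.pi * v))⁻¹
  refine h.congr_deriv ?_
  simp only [gaussianPDFReal, id_eq, Pi.neg_apply, Pi.pow_apply, Nat.cast_ofNat,
    Nat.add_one_sub_one, pow_one, mul_one, neg_mul]
  ring

theorem integrable_gaussianReal_iff {E : Type*} [NormedAddCommGroup E] [NormedSpace ℝ E] {μ : ℝ}
    {v : NNReal} (hv : v ≠ 0) {f : ℝ → E} :
    Integrable f (gaussianReal μ v) ↔ Integrable fun x => gaussianPDFReal μ v x • f x := by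
  rw [gaussianReal_of_var_ne_zero μ hv, integrable_withDensity_iff_integrable_smul'
    (measurable_gaussianPDF μ v) (ae_of_all _ fun _ => gaussianPDF_lt_top)]
  simp only [toReal_gaussianPDF]

/-- **Stein's lemma**. -/
theorem integral_sub_mul_gaussianReal {μ : ℝ} {v : NNReal} {f f' : ℝ → ℝ}
    (hff' : ∀ x, HasDerivAt f (f' x) x) (hf : Integrable f (gaussianReal μ v))
    (hf' : Integrable f' (gaussianReal μ v))
    (hxf : Integrable (fun x => (x - μ) * f x) (gaussianReal μ v)) :
    ∫ x, (x - μ) * f x ∂gaussianReal μ v = v * ∫ x, f' x ∂gaussianReal μ v := by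
  rcases eq_or_ne v 0 with rfl | hv
  · simp [gaussianReal_zero_var]
  rw [integrable_gaussianReal_iff hv] at hf hf' hxf
  have hv' : (v : ℝ) ≠ 0 := NNReal.coe_ne_zero.2 hv
  have by_parts := integral_mul_deriv_eq_deriv_mul_of_integrable (fun x _ => hff' x)
    (fun x _ => hasDerivAt_gaussianPDFReal μ v x)
    ((hxf.const_mul (-(v : ℝ)⁻¹)).congr (ae_of_all _ fun x => by
      simp only [smul_eq_mul, Pi.mul_apply]
      ring))
    (hf'.congr (ae_of_all _ fun x => mul_comm _ _)) (hf.congr (ae_of_all _ fun x => mul_comm _ _))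
  rw [integral_gaussianReal_eq_integral_smul hv, integral_gaussianReal_eq_integral_smul hv]
  calc ∫ x, gaussianPDFReal μ v x • ((x - μ) * f x)
      = ∫ x, -v * (f x * (-((x - μ) / v) * gaussianPDFReal μ v x)) := by
        refine integral_congr_ae (ae_of_all _ fun x => ?_)
        simp only [smul_eq_mul]
        field_simp
    _ = v * ∫ x, f' x * gaussianPDFReal μ v x := by
        rw [integral_const_mul, by_parts, neg_mul_neg]
    _ = v * ∫ x, gaussianPDFReal μ v x • f' x := by simp only [smul_eq_mul, mul_comm]

theorem integrable_eval_gaussianReal (μ : ℝ) (v : NNReal) (P : Polynomial ℝ) :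
    Integrable (fun x => P.eval x) (gaussianReal μ v) :=
  integrable_polynomial_eval (X := id) (fun q => memLp_id_gaussianReal q) P

/-- The expectation of polynomials under the standard Gaussian law, as a linear form. -/
noncomputable def gaussianExpectation : Polynomial ℝ →ₗ[ℝ] ℝ where
  toFun P := ∫ x, P.eval x ∂gaussianReal 0 1
  map_add' P Q := by
    simpa using integral_add (integrable_eval_gaussianReal 0 1 P)
      (integrable_eval_gaussianReal 0 1 Q)
  map_smul' a P := by simp [integral_const_mul]

theorem gaussianExpectation_apply (P : Polynomial ℝ) :
    gaussianExpectation P = ∫ x, P.eval x ∂gaussianReal 0 1 := rfl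

theorem gaussianExpectation_X_mul (P : Polynomial ℝ) :
    gaussianExpectation (Polynomial.X * P) = gaussianExpectation P.derivative := by
  have integrable := integrable_eval_gaussianReal 0 1
  simpa [gaussianExpectation_apply] using integral_sub_mul_gaussianReal (μ := 0) (v := 1)
    P.hasDerivAt (integrable P) (integrable P.derivative)
    ((integrable (Polynomial.X * P)).congr (ae_of_all _ fun x => by simp))

theorem derivative_hermite_succ (r : ℕ) :
    Polynomial.derivative (Polynomial.hermite (r + 1)) =
      ((r : Polynomial ℤ) + 1) * Polynomial.hermite r := by
  induction r with
  | zero => simp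
  | succ r ih =>
    rw [Polynomial.hermite_succ (r + 1), Polynomial.derivative_sub, Polynomial.derivative_mul, ih,
      Polynomial.hermite_succ r]
    simp only [Polynomial.derivative_X, one_mul, Polynomial.derivative_mul,
      Polynomial.derivative_add, Polynomial.derivative_natCast, Polynomial.derivative_one, add_zero,
      zero_mul, zero_add, Nat.cast_add, Nat.cast_one]
    ring

theorem hermite_add_two (r : ℕ) :
    Polynomial.hermite (r + 2) =
      Polynomial.X * Polynomial.hermite (r + 1) -
        ((r : Polynomial ℤ) + 1) * Polynomial.hermite r := by
  rw [Polynomial.hermite_succ (r + 1), derivative_hermite_succ]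

/-- The Hermite polynomial `σ ^ r * He_r`. Evaluated at a standard Gaussian variable `g`, it is the
monic Hermite polynomial of variance `σ ^ 2` evaluated at `σ * g`. -/
noncomputable def scaledHermite (σ : ℝ) (r : ℕ) : Polynomial ℝ :=
  σ ^ r • (Polynomial.hermite r).map (Int.castRingHom ℝ)

theorem isThreeTermRecurrence_scaledHermite (σ : ℝ) :
    IsThreeTermRecurrence (fun r => (r + 1) * σ ^ 2) (scaledHermite σ) where
  zero := by simp [scaledHermite]
  add_two r := by
    simp only [scaledHermite, hermite_add_two, Polynomial.hermite_one, Polynomial.smul_eq_C_mul,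
      Polynomial.map_sub, Polynomial.map_mul, Polynomial.map_add, Polynomial.map_X,
      Polynomial.map_natCast, Polynomial.map_one, map_mul, map_add, map_pow, map_natCast, map_one,
      pow_one]
    ring

theorem gaussianExpectation_scaledHermite (σ : ℝ) (r : ℕ) :
    gaussianExpectation (scaledHermite σ r) = if r = 0 then 1 else 0 := by
  cases r with
  | zero => simp [scaledHermite, gaussianExpectation_apply]
  | succ r =>
    simp [scaledHermite, Polynomial.hermite_succ, gaussianExpectation_X_mul,
      Polynomial.derivative_map]

/-! ### Group algebra elements supported in independent subgroups -/

section TraceFactorization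

/-- The elements of a group algebra that are supported in a subgroup, as a subalgebra. -/
noncomputable def supportedSubalgebra (𝕜 : Type*) {G : Type*} [CommSemiring 𝕜] [AddGroup G]
    (H : AddSubgroup G) : Subalgebra 𝕜 (AddMonoidAlgebra 𝕜 G) :=
  (AddMonoidAlgebra.supported 𝕜 𝕜 (H : Set G)).toSubalgebra
    (by
      rw [AddMonoidAlgebra.supported_eq_span_single]
      exact Submodule.subset_span ⟨0, H.zero_mem, rfl⟩)
    (by
      intro x y hx hy
      rw [AddMonoidAlgebra.supported_eq_span_single] at hx hy ⊢
      have hxy := Submodule.mul_mem_mul hx hy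
      rw [Submodule.span_mul_span] at hxy
      refine Submodule.span_mono ?_ hxy
      rintro _ ⟨_, ⟨g, hg, rfl⟩, _, ⟨h, hh, rfl⟩, rfl⟩
      exact ⟨g + h, H.add_mem hg hh, by simp [AddMonoidAlgebra.single_mul_single]⟩)

variable {𝕜 G : Type*} [CommSemiring 𝕜]

theorem single_mem_supportedSubalgebra [AddGroup G] {H : AddSubgroup G} {g : G} (hg : g ∈ H)
    (a : 𝕜) : AddMonoidAlgebra.single g a ∈ supportedSubalgebra 𝕜 H :=
  AddMonoidAlgebra.mem_supported'.2 fun _ hh =>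
    Finsupp.single_eq_of_ne fun hgh => hh (hgh ▸ hg)

theorem supportedSubalgebra_mono [AddGroup G] {H K : AddSubgroup G} (h : H ≤ K) :
    supportedSubalgebra 𝕜 H ≤ supportedSubalgebra 𝕜 K :=
  AddMonoidAlgebra.supported_mono h

theorem coeff_zero_mul_of_disjoint [AddGroup G] {H K : AddSubgroup G} (hHK : Disjoint H K)
    {x y : AddMonoidAlgebra 𝕜 G} (hx : x ∈ supportedSubalgebra 𝕜 H)
    (hy : y ∈ supportedSubalgebra 𝕜 K) : (x * y).coeff 0 = x.coeff 0 * y.coeff 0 := by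
  classical
  rw [supportedSubalgebra, Submodule.mem_toSubalgebra,
    AddMonoidAlgebra.supported_eq_span_single] at hx hy
  induction hx, hy using Submodule.span_induction₂ with
  | mem_mem _ _ hx hy =>
    obtain ⟨g, hg, rfl⟩ := hx
    obtain ⟨h, hh, rfl⟩ := hy
    have add_eq_zero : g + h = 0 ↔ g = 0 ∧ h = 0 := by
      refine ⟨fun hgh => ?_, by rintro ⟨rfl, rfl⟩; exact add_zero 0⟩
      have hg₀ : g = 0 := AddSubgroup.disjoint_def.1 hHK hg <| by
        simpa [eq_neg_of_add_eq_zero_left hgh] using hh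
      exact ⟨hg₀, by simpa [hg₀] using hgh⟩
    simp only [AddMonoidAlgebra.single_mul_single, AddMonoidAlgebra.coeff_single,
      Finsupp.single_apply, add_eq_zero, mul_one, ite_and, ite_mul, one_mul, zero_mul]
  | zero_left => simp
  | zero_right => simp
  | add_left x₁ x₂ y _ _ _ h₁ h₂ => simp [add_mul, h₁, h₂]
  | add_right x y₁ y₂ _ _ _ h₁ h₂ => simp [mul_add, h₁, h₂]
  | smul_left a x y _ _ h => simp [h, mul_assoc]
  | smul_right a x y _ _ h => simp [h, mul_left_comm]

theorem coeff_zero_prod_of_iSupIndep [AddCommGroup G] {ι : Type*} {H : ι → AddSubgroup G}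
    (hH : iSupIndep H) {x : ι → AddMonoidAlgebra 𝕜 G}
    (hx : ∀ i, x i ∈ supportedSubalgebra 𝕜 (H i)) (s : Finset ι) :
    (∏ i ∈ s, x i).coeff 0 = ∏ i ∈ s, (x i).coeff 0 := by
  classical
  induction s using Finset.induction_on with
  | empty => simp [AddMonoidAlgebra.one_def]
  | insert i s hi ih =>
    have prod_mem : ∏ j ∈ s, x j ∈ supportedSubalgebra 𝕜 (⨆ j ∈ s, H j) :=
      Subalgebra.prod_mem _ fun j hj => supportedSubalgebra_mono (le_biSup H hj) (hx j)
    rw [Finset.prod_insert hi, Finset.prod_insert hi, ← ih,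
      coeff_zero_mul_of_disjoint (hH.disjoint_biSup hi) (hx i) prod_mem]

/-- The subgroup of the finite subsets of `I`. -/
def subsetsOf {α : Type*} [DecidableEq α] (I : Set α) : AddSubgroup (AsBoolRing (Finset α)) where
  carrier := {A | ((ofBoolRing A : Finset α) : Set α) ⊆ I}
  zero_mem' := (Finset.coe_empty.subset).trans (Set.empty_subset I)
  add_mem' {A B} hA hB := by
    change ((symmDiff (ofBoolRing A) (ofBoolRing B) : Finset α) : Set α) ⊆ I
    rw [Finset.coe_symmDiff]
    exact symmDiff_le_sup.trans (sup_le hA hB)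
  neg_mem' hA := hA

theorem iSupIndep_subsetsOf {α ι : Type*} [DecidableEq α] {I : ι → Set α}
    (hI : Pairwise fun i j => Disjoint (I i) (I j)) : iSupIndep fun i => subsetsOf (I i) := by
  intro i
  have iSup_le_subsetsOf : ⨆ j ≠ i, subsetsOf (I j) ≤ subsetsOf (I i)ᶜ :=
    iSup₂_le fun j hj A hA => hA.trans (hI hj).subset_compl_right
  refine Disjoint.mono_right iSup_le_subsetsOf (AddSubgroup.disjoint_def.2 fun {A} hA hA' => ?_)
  have : ((ofBoolRing A : Finset α) : Set α) = ∅ := Set.subset_empty_iff.1 <|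
    (Set.subset_inter hA hA').trans (Set.inter_compl_self _).subset
  exact Finset.coe_eq_empty.1 this

end TraceFactorization

/-! ### The normalized sums -/

/-- The generator `{a}` of the group, scaled by `n ^ (-1/2)`. -/
noncomputable def scaledGenerator (n a : ℕ) : SetAlgebra :=
  (√(n : ℝ))⁻¹ • AddMonoidAlgebra.single (toBoolRing {a}) 1

theorem scaledGenerator_mul_self (n a : ℕ) :
    scaledGenerator n a * scaledGenerator n a = algebraMap ℝ SetAlgebra (n : ℝ)⁻¹ := by
  have add_self : (toBoolRing {a} + toBoolRing {a} : FinSetGroup) = 0 :=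
    symmDiff_self ({a} : Finset ℕ)
  rw [scaledGenerator, smul_mul_smul_comm, AddMonoidAlgebra.single_mul_single, add_self, one_mul,
    ← AddMonoidAlgebra.one_def, ← mul_inv, Real.mul_self_sqrt n.cast_nonneg,
    Algebra.algebraMap_eq_smul_one]

theorem prod_single_toBoolRing_singleton (s : Finset ℕ) :
    ∏ a ∈ s, (AddMonoidAlgebra.single (toBoolRing {a}) 1 : SetAlgebra) =
      AddMonoidAlgebra.single (toBoolRing s) 1 := by
  induction s using Finset.induction_on with
  | empty => rfl
  | insert a s ha ih =>
    have add_eq_insert : (toBoolRing {a} + toBoolRing s : FinSetGroup) = toBoolRing (insert a s) :=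
      congrArg toBoolRing ((Finset.disjoint_singleton_left.2 ha).symmDiff_eq_sup)
    rw [Finset.prod_insert ha, ih, AddMonoidAlgebra.single_mul_single, add_eq_insert, one_mul]

theorem natCast_rpow_neg_div_two (n r : ℕ) : (n : ℝ) ^ (-(r : ℝ) / 2) = (√(n : ℝ))⁻¹ ^ r := by
  rw [Real.sqrt_eq_rpow, ← Real.rpow_neg n.cast_nonneg, ← Real.rpow_mul_natCast n.cast_nonneg]
  ring_nf

theorem normalizedSum_eq_factorial_smul_esymm (r : ℕ) (s t : ℝ) (n : ℕ) :
    normalizedSum r s t n =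
      r.factorial • ((integersIoc (n * s) (n * t)).val.map (scaledGenerator n)).esymm r := by
  classical
  rw [normalizedSum, ← sum_injective_prod_eq_factorial_smul_esymm, Finset.smul_sum]
  refine Finset.sum_congr (by congr!) fun a ha => ?_
  simp only [scaledGenerator]
  rw [Finset.prod_smul, Finset.prod_const, Finset.card_fin, natCast_rpow_neg_div_two,
    Complex.coe_smul, ← prod_single_toBoolRing_singleton,
    Finset.prod_image (Finset.mem_filter.1 ha).2.injOn]

theorem isThreeTermRecurrence_normalizedSum (s t : ℝ) (n : ℕ) :
    IsThreeTermRecurrence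
      (fun r => ((r : ℝ) + 1) * ((integersIoc (n * s) (n * t)).card - r) * (n : ℝ)⁻¹)
      (fun r => normalizedSum r s t n) := by
  have mul_self : ∀ x ∈ (integersIoc (n * s) (n * t)).val.map (scaledGenerator n),
      x * x = algebraMap ℝ SetAlgebra (n : ℝ)⁻¹ := by
    simp only [Multiset.mem_map]
    rintro _ ⟨a, -, rfl⟩
    exact scaledGenerator_mul_self n a
  simpa only [normalizedSum_eq_factorial_smul_esymm, Multiset.card_map, Finset.card_val] using
    isThreeTermRecurrence_factorial_smul_esymm mul_self

theorem canonicalTrace_normalizedSum (r : ℕ) (s t : ℝ) (n : ℕ) :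
    canonicalTrace (normalizedSum r s t n) = if r = 0 then 1 else 0 := by
  cases r with
  | zero =>
    rw [(isThreeTermRecurrence_normalizedSum s t n).zero, if_pos rfl]
    exact Finsupp.single_eq_same
  | succ r =>
    have ne_zero (a : Fin (r + 1) → ℕ) : toBoolRing (Finset.univ.image a) ≠ 0 :=
      (Finset.univ_nonempty.image a).ne_empty
    rw [normalizedSum, map_smul, map_sum, Finset.sum_eq_zero fun a _ => ?_]
    · simp
    · exact Finsupp.single_eq_of_ne' (ne_zero a)

theorem normalizedSum_mem_supportedSubalgebra (r : ℕ) (s t : ℝ) (n : ℕ) :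
    normalizedSum r s t n ∈
      supportedSubalgebra ℂ (subsetsOf (integersIoc (n * s) (n * t) : Set ℕ)) := by
  refine Subalgebra.smul_mem _ (Subalgebra.sum_mem _ fun a ha => ?_) _
  rw [Finset.mem_filter, Fintype.mem_piFinset] at ha
  refine single_mem_supportedSubalgebra ?_ 1
  exact Finset.coe_subset.2 (Finset.image_subset_iff.2 fun i _ => ha.1 i)

theorem disjoint_integersIoc {s t s' t' : ℝ} (h : Disjoint (Set.Ioc s t) (Set.Ioc s' t')) (n : ℕ) :
    Disjoint (integersIoc (n * s) (n * t)) (integersIoc (n * s') (n * t')) := by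
  rw [Finset.disjoint_left]
  intro a ha ha'
  rw [mem_integersIoc] at ha ha'
  rcases n.eq_zero_or_pos with rfl | hn
  · rw [Nat.cast_zero, zero_mul, zero_mul] at ha
    exact absurd (ha.1.trans_le ha.2) (lt_irrefl 0)
  · have hn : (0 : ℝ) < n := Nat.cast_pos.2 hn
    exact Set.disjoint_left.1 h
      (show (a / n : ℝ) ∈ _ from ⟨(lt_div_iff₀' hn).2 ha.1, (div_le_iff₀' hn).2 ha.2⟩)
      ⟨(lt_div_iff₀' hn).2 ha'.1, (div_le_iff₀' hn).2 ha'.2⟩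

theorem canonicalTrace_prod_normalizedSum_pow {ι : Type*} [Fintype ι] (r : ι → ℕ) {s t : ι → ℝ}
    (hst : Pairwise fun i j => Disjoint (Set.Ioc (s i) (t i)) (Set.Ioc (s j) (t j))) (n : ℕ)
    (k : ι → ℕ) :
    canonicalTrace (∏ i, normalizedSum (r i) (s i) (t i) n ^ k i) =
      ∏ i, canonicalTrace (normalizedSum (r i) (s i) (t i) n ^ k i) :=
  coeff_zero_prod_of_iSupIndep
    (iSupIndep_subsetsOf fun _ _ hij => Finset.disjoint_coe.2 (disjoint_integersIoc (hst hij) n))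
    (fun i => Subalgebra.pow_mem _ (normalizedSum_mem_supportedSubalgebra _ _ _ _) (k i)) _

theorem integersIoc_eq_Ico (s t : ℝ) :
    integersIoc s t = Finset.Ico (⌊s⌋ + 1).toNat (⌊t⌋ + 1).toNat := by
  ext a
  rw [mem_integersIoc, Finset.mem_Ico, Int.toNat_le, Int.lt_toNat, Int.add_one_le_iff,
    Int.lt_add_one_iff, Int.floor_lt, Int.le_floor, Int.cast_natCast]

theorem tendsto_toNat_floor_natCast_mul_add_one_div (t : ℝ) :
    Tendsto (fun n : ℕ => ((⌊n * t⌋ + 1).toNat : ℝ) / n) atTop (𝓝 (max t 0)) := by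
  have lower (x : ℝ) : max x 0 ≤ (⌊x⌋ + 1).toNat := by
    refine max_le ?_ (Nat.cast_nonneg _)
    calc x ≤ (⌊x⌋ + 1 : ℤ) := by push_cast; exact (Int.lt_floor_add_one x).le
      _ ≤ (⌊x⌋ + 1).toNat := by exact_mod_cast Int.self_le_toNat _
  have upper (x : ℝ) : ((⌊x⌋ + 1).toNat : ℝ) ≤ max x 0 + 1 := by
    rw [← Int.cast_natCast, Int.toNat_eq_max, Int.cast_max, Int.cast_add, Int.cast_one,
      Int.cast_zero]
    exact max_le (by grw [Int.floor_le x]; gcongr; exact le_max_left x 0) (by positivity)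
  have max_mul (n : ℕ) : max (n * t) 0 = n * max t 0 := by
    rw [mul_max_of_nonneg _ _ n.cast_nonneg, mul_zero]
  refine tendsto_of_tendsto_of_tendsto_of_le_of_le' tendsto_const_nhds
    (h := fun n : ℕ => max t 0 + 1 / (n : ℝ)) ?_ ?_ ?_
  · simpa using tendsto_const_nhds.add (tendsto_const_div_atTop_nhds_zero_nat (1 : ℝ))
  · filter_upwards [eventually_gt_atTop 0] with n hn
    rw [le_div_iff₀' (Nat.cast_pos.2 hn), ← max_mul]
    exact lower _
  · filter_upwards [eventually_gt_atTop 0] with n hn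
    have hn : (0 : ℝ) < n := Nat.cast_pos.2 hn
    rw [div_le_iff₀' hn, mul_add, ← max_mul, mul_one_div_cancel hn.ne']
    exact upper _

theorem tendsto_card_integersIoc_div (s t : ℝ) :
    Tendsto (fun n : ℕ => ((integersIoc (n * s) (n * t)).card : ℝ) / n) atTop
      (𝓝 (max (max t 0 - max s 0) 0)) := by
  have natCast_sub (a b : ℕ) : ((a - b : ℕ) : ℝ) = max ((a : ℝ) - b) 0 := by
    rcases le_total a b with h | h <;> simp [h]
  have h := ((tendsto_toNat_floor_natCast_mul_add_one_div t).sub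
    (tendsto_toNat_floor_natCast_mul_add_one_div s)).max (tendsto_const_nhds (x := (0 : ℝ)))
  refine h.congr fun n => ?_
  rw [integersIoc_eq_Ico, Nat.card_Ico, natCast_sub, ← sub_div, ← zero_div (n : ℝ),
    max_div_div_right n.cast_nonneg, zero_div]

-- When `t ≤ s` the interval is empty, in agreement with `√` being `0` on negative numbers.
theorem tendsto_canonicalTrace_normalizedSum_pow (r : ℕ) (s t : ℝ) (k : ℕ) :
    Tendsto (fun n => canonicalTrace (normalizedSum r s t n ^ k)) atTop
      (𝓝 (gaussianExpectation (scaledHermite √(max t 0 - max s 0) r ^ k) : ℂ)) := by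
  have tendsto_coeff (r : ℕ) : Tendsto
      (fun n : ℕ => ((r : ℝ) + 1) * ((integersIoc (n * s) (n * t)).card - r) * (n : ℝ)⁻¹) atTop
      (𝓝 ((r + 1) * √(max t 0 - max s 0) ^ 2)) := by
    have h := ((tendsto_card_integersIoc_div s t).sub
      (tendsto_const_div_atTop_nhds_zero_nat (r : ℝ))).const_mul ((r : ℝ) + 1)
    rw [sub_zero, ← Real.sq_sqrt'] at h
    exact h.congr fun n => by ring
  exact IsThreeTermRecurrence.tendsto_pow (φ := canonicalTrace.restrictScalars ℝ)
    (Φ := Algebra.linearMap ℝ ℂ ∘ₗ gaussianExpectation)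
    (fun n => isThreeTermRecurrence_normalizedSum s t n)
    (isThreeTermRecurrence_scaledHermite _) tendsto_coeff
    (fun r => by simp [canonicalTrace_normalizedSum, gaussianExpectation_scaledHermite]) r k

/-! ### Asymptotic independence from moments -/

/-- The map from noncommutative to commutative polynomials that makes the variables commute. -/
noncomputable def abelianize (𝕜 ι : Type*) [CommSemiring 𝕜] :
    FreeAlgebra 𝕜 ι →ₐ[𝕜] MvPolynomial ι 𝕜 :=
  FreeAlgebra.lift 𝕜 MvPolynomial.X

theorem lift_eq_sum_coeff_smul_prod_pow {𝕜 A ι : Type*} [CommSemiring 𝕜] [CommSemiring A]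
    [Algebra 𝕜 A] [Fintype ι] (x : ι → A) (P : FreeAlgebra 𝕜 ι) :
    FreeAlgebra.lift 𝕜 x P = ∑ m ∈ (abelianize 𝕜 ι P).support,
      (abelianize 𝕜 ι P).coeff m • ∏ i, x i ^ m i := by
  have lift_eq_aeval :
      FreeAlgebra.lift 𝕜 x = (MvPolynomial.aeval x).comp (abelianize 𝕜 ι) := by
    ext i
    simp [abelianize]
  rw [lift_eq_aeval, AlgHom.comp_apply, MvPolynomial.aeval_def, MvPolynomial.eval₂_eq']
  simp only [Algebra.smul_def]

theorem asymptoticallyIndependent_of_tendsto_moments {A : Type*} {ι : Type} [Fintype ι]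
    [CommRing A] [Algebra ℂ A] {φ : A →ₗ[ℂ] ℂ} {x : ℕ → ι → A} {Ω : ι → Type}
    [∀ i, MeasurableSpace (Ω i)] {μ : ∀ i, Measure (Ω i)} [∀ i, IsProbabilityMeasure (μ i)]
    {X : ∀ i, Ω i → ℝ}
    (hX : ∀ i, Measurable (X i)) (hX' : ∀ i (q : ℕ), MemLp (X i) q (μ i))
    (hmul : ∀ n (k : ι → ℕ), φ (∏ i, x n i ^ k i) = ∏ i, φ (x n i ^ k i))
    (hlim : ∀ i k, Tendsto (fun n => φ (x n i ^ k)) atTop (𝓝 ((∫ ω, X i ω ^ k ∂μ i : ℝ) : ℂ))) :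
    AsymptoticallyIndependent φ x := by
  have integrable_pow (i : ι) (k : ℕ) : Integrable (fun ω => ((X i ω : ℝ) : ℂ) ^ k) (μ i) := by
    simpa using (integrable_polynomial_eval (hX' i) (Polynomial.X ^ k)).ofReal (𝕜 := ℂ)
  refine ⟨∀ i, Ω i, inferInstance, Measure.pi μ, fun i ω => X i (ω i), inferInstance,
    fun i => (hX i).comp (measurable_pi_apply i),
    fun i q => (hX' i q).comp_measurePreserving (measurePreserving_eval μ i),
    iIndepFun_pi fun i => (hX i).aemeasurable, fun P => ?_⟩
  simp only [ncDistribution, LinearMap.comp_apply, AlgHom.toLinearMap_apply,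
    lift_eq_sum_coeff_smul_prod_pow, map_sum, map_smul, hmul]
  rw [integral_finsetSum _ fun m _ => (Integrable.fintype_prod_dep fun i =>
    integrable_pow i (m i)).fun_smul _]
  refine tendsto_finsetSum _ fun m _ => ?_
  rw [integral_smul, integral_fintype_prod_eq_prod (f := fun i ω => ((X i ω : ℝ) : ℂ) ^ m i)]
  refine (tendsto_finsetProd _ fun i _ => ?_).const_smul _
  simpa only [← Complex.ofReal_pow, integral_complex_ofReal] using hlim i (m i)

theorem mainTheorem7_general {ι : Type} [Finite ι] (r : ι → ℕ) (s t : ι → ℝ)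
    (hst : Pairwise fun i j => Disjoint (Set.Ioc (s i) (t i)) (Set.Ioc (s j) (t j))) :
    AsymptoticallyIndependent canonicalTrace
      (fun n i => normalizedSum (r i) (s i) (t i) n) := by
  have := Fintype.ofFinite ι
  refine asymptoticallyIndependent_of_tendsto_moments (μ := fun _ => gaussianReal 0 1)
    (fun i => (scaledHermite √(max (t i) 0 - max (s i) 0) (r i)).continuous.measurable)
    (fun _ q => memLp_polynomial_eval (X := id) (fun q => memLp_id_gaussianReal q) _ q)
    (canonicalTrace_prod_normalizedSum_pow r hst) fun i k => ?_
  simpa only [gaussianExpectation_apply, Polynomial.eval_pow] using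
    tendsto_canonicalTrace_normalizedSum_pow (r i) (s i) (t i) k

theorem mainTheorem7 (p : ℕ) (hp : 1 ≤ p) (r : Fin p → ℕ) (t : Fin (p + 1) → ℝ)
    (ht : StrictMono t) :
    AsymptoticallyIndependent canonicalTrace
      (fun (n : ℕ) (i : Fin p) => normalizedSum (r i) (t i.castSucc) (t i.succ) n) :=
  mainTheorem7_general r _ _ fun i j hij => by
    simpa only [Function.onFun, Fin.orderSucc_castSucc] using
      ht.monotone.pairwise_disjoint_on_Ioc_succ ((Fin.castSucc_injective p).ne hij)
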